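/- Let $N\ge 1$ and let $K$ be a field of characteristic zero (for instance $\mathbb{C}$). For integers $0\le n_1,\dots,n_N<N$ let $[n_1\cdots n_N]\in K[t_1,\dots,t_N]$ be the confluent Vandermonde form, i.e. the determinant of the $N\times N$ matrix whose entry in row $i$ and column $j$ ($1\le i,j\le N$) is $t_j^{\,n_j-i+1}/(n_j-i+1)!$ if $i\le n_j+1$, and $0$ otherwise. Let $\widetilde\Delta_N=\prod_{1\le i<j\le N}\frac{t_i-t_j}{j-i}$ be the normalized Vandermonde form. A polynomial $f\in K[t_1,\dots,t_N]$ is called $S_N$-harmonic if $\sum_{i=1}^N\partial_{t_i}^k f=0$ for all $k\ge 1$. A ribbon with $N$ boxes is a connected skew Young diagram (English convention) with $N$ boxes that contains no $2\times 2$ square of boxes, considered up to translation; number its rows from the top starting with $0$, and its columns so that the rightmost one has number $N-1$. A standard ribbon tableau with $N$ boxes is a bijective filling of such a ribbon with $1,\dots,N$ that increases along rows from left to right and down columns. To a standard ribbon tableau $T$ assign the sequence $n(T)=(n_1,\dots,n_N)$, where $n_i$ is the column number of the box with entry $N-i+1$ (reversed reading), and let $d(T)$ be the sum of the row numbers of its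 $N$ boxes. Theorem. 1. For all $0\le n_1,\dots,n_N<N$ one has $[n_1\cdots n_N]=\partial_{t_1}^{N-1-n_1}\cdots\partial_{t_N}^{N-1-n_N}\widetilde\Delta_N$. 2. There are exactly $N!$ standard ribbon tableaux with $N$ boxes (on all ribbons with $N$ boxes), the map $T\mapsto n(T)$ is injective on them, and the $N!$ confluent Vandermonde forms $[n(T)]$ are linearly independent over $K$. 3. The space of $S_N$-harmonic polynomials has dimension $N!$ over $K$ and is spanned by the forms $[n(T)]$, which therefore form a basis of it. 4. This basis is graded: $[n(T)]$ is homogeneous of degree $d(T)=\sum_{i=1}^N n_i-\frac{N(N-1)}{2}$, and for every $d\ge 0$ the forms $[n(T)]$ with $d(T)=d$ span the space of all homogeneous $S_N$-harmonic polynomials of degree $d$ (with $0$ included). -/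

import Mathlib

open scoped Nat

/-- Two boxes of the square grid (row, column) are adjacent if they share an edge. -/
def boxGraph : SimpleGraph (ℕ × ℕ) where
  Adj c d :=
    (c.1 = d.1 ∧ (c.2 + 1 = d.2 ∨ d.2 + 1 = c.2)) ∨
      (c.2 = d.2 ∧ (c.1 + 1 = d.1 ∨ d.1 + 1 = c.1))
  symm := ⟨fun c d h => by
    rcases h with ⟨h, h' | h'⟩ | ⟨h, h' | h'⟩ <;> simp [h, h']⟩
  loopless := ⟨fun c h => by
    rcases h with ⟨_, h' | h'⟩ | ⟨_, h' | h'⟩ <;> omega⟩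

/-- Ribbons with `N` boxes: connected skew Young diagrams (English convention, a box is a pair
(row, column)) without a `2 × 2` square. As ribbons are considered up to translation, the
placement is fixed by letting the top row be row `0` and the rightmost column be column `N - 1`:
the upper right box is `(0, N - 1)`. -/
structure Ribbon (N : ℕ) where
  cells : Finset (ℕ × ℕ)
  card_cells : cells.card = N
  isSkew : ∃ μ lam : YoungDiagram, μ ≤ lam ∧ cells = lam.cells \ μ.cells
  connected : (boxGraph.induce (cells : Set (ℕ × ℕ))).Connected
  no_square : ∀ i j : ℕ,
    ¬ ((i, j) ∈ cells ∧ (i, j + 1) ∈ cells ∧ (i + 1, j) ∈ cells ∧ (i + 1, j + 1) ∈ cells)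
  upper_right_mem : (0, N - 1) ∈ cells
  col_lt : ∀ c ∈ cells, c.2 < N

/-- Standard tableaux on all ribbons with `N` boxes. The entries `1, …, N` are represented by
the elements `0, …, N - 1` of `Fin N`; they increase along rows (to the right) and down columns. -/
structure StandardRibbonTableau (N : ℕ) where
  shape : Ribbon N
  entry : {c : ℕ × ℕ // c ∈ shape.cells} ≃ Fin N
  row_lt : ∀ c d : {c : ℕ × ℕ // c ∈ shape.cells},
    c.1.1 = d.1.1 → c.1.2 < d.1.2 → entry c < entry d
  col_lt : ∀ c d : {c : ℕ × ℕ // c ∈ shape.cells},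
    c.1.2 = d.1.2 → c.1.1 < d.1.1 → entry c < entry d

namespace StandardRibbonTableau

/-- The column coordinates of the boxes, read in the reversed order of filling: the first value is
the column of the box with the largest entry, the last one that of the box with the smallest. -/
def reverseReading {N : ℕ} (T : StandardRibbonTableau N) (i : Fin N) : Fin N :=
  ⟨(T.entry.symm i.rev).1.2, T.shape.col_lt _ (T.entry.symm i.rev).2⟩

/-- The sum of the row coordinates of all boxes (the top row being row `0`). -/
def index {N : ℕ} (T : StandardRibbonTableau N) : ℕ :=
  ∑ c ∈ T.shape.cells, c.1

end StandardRibbonTableau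

noncomputable section

/-- The confluent Vandermonde form `[n₁ ⋯ n_N]`: the determinant whose entry in row `i` (counted
from `0`) and column `j` is `t_j ^ (n_j - i) / (n_j - i)!`, and `0` if `i > n_j`. -/
def cvForm (K : Type*) [Field K] {N : ℕ} (n : Fin N → Fin N) : MvPolynomial (Fin N) K :=
  Matrix.det (Matrix.of fun i j : Fin N =>
    if (i : ℕ) ≤ (n j : ℕ) then
      MvPolynomial.C ((((n j : ℕ) - (i : ℕ))! : K)⁻¹) * MvPolynomial.X j ^ ((n j : ℕ) - (i : ℕ))
    else 0)

/-- The normalized Vandermonde form `∏_{i < j} (t_i - t_j) / (j - i)`. -/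
def vandermondeForm (K : Type*) [Field K] (N : ℕ) : MvPolynomial (Fin N) K :=
  ∏ i : Fin N, ∏ j ∈ Finset.Ioi i,
    MvPolynomial.C ((((j : ℕ) : K) - ((i : ℕ) : K))⁻¹) * (MvPolynomial.X i - MvPolynomial.X j)

/-- The partial derivative with respect to `t_i`, as a `K`-linear endomorphism. -/
def partialDeriv (K : Type*) [Field K] {N : ℕ} (i : Fin N) :
    Module.End K (MvPolynomial (Fin N) K) :=
  (MvPolynomial.pderiv i : Derivation K (MvPolynomial (Fin N) K) (MvPolynomial (Fin N) K))

/-- The iterated partial derivative `∂₁ ^ a₁ ⋯ ∂_N ^ a_N`. -/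
def iteratedPartialDeriv (K : Type*) [Field K] {N : ℕ} (a : Fin N → ℕ) :
    Module.End K (MvPolynomial (Fin N) K) :=
  (List.ofFn fun i : Fin N => partialDeriv K i ^ a i).prod

/-- The symmetrized derivative `∑ i, ∂_i ^ k`. -/
def symmetrizedDeriv (K : Type*) [Field K] (N k : ℕ) :
    Module.End K (MvPolynomial (Fin N) K) :=
  ∑ i : Fin N, partialDeriv K i ^ k

/-- The `S_N`-harmonic polynomials: those annihilated by all symmetrized derivatives of
positive order. -/
def harmonicPolynomials (K : Type*) [Field K] (N : ℕ) :
    Submodule K (MvPolynomial (Fin N) K) :=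
  ⨅ k : ℕ, ⨅ _ : 1 ≤ k, LinearMap.ker (symmetrizedDeriv K N k)

end

/-! Differentiation shifts divided powers, so the confluent forms are the derivatives `∂^a Δ` of the
normalized Vandermonde form `Δ`. They are harmonic because applying `∑ ∂_l^k` to the determinant
multiplies it by the trace of a strictly triangular shift matrix (`sum_shiftedForm_add_single`).

The rest is a count. By Newton's identities a harmonic `h` is killed by every elementary symmetric
operator of positive order, so `∑_{|S| = k} ∂^(c + 1_S) h = 0` for every exponent `c` and `k ≥ 1`.
The term of largest energy in this relation is the one whose `S` carries the `k` largest keys, and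
it can be eliminated. Hence all `∂^a h` are combinations of those with `a` reduced
(`mem_of_forall_isReducedExponent`). Sorting a reduced exponent by its keys gives a lattice path
with a standard filling, that is, a ribbon tableau (`IsReducedExponent.exists_tableau`).

Straightening is used twice. For `h = Δ` it puts every `∂^a Δ` into the span of the tableau forms;
this span has dimension at least `N!`, since the `∂^a Δ` with `a_i ≤ N - 1 - i` (`i` from `0`) have
distinct leading monomials. For arbitrary `h`, it shows that the constant terms of the tableau
derivatives determine `h`, so the harmonic space has dimension at most the number of tableaux. That
number is at most `N!`, as a tableau is determined by the order of its entries along the ribbon.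
Thus `N! ≤ dim span ≤ dim harmonics ≤ #tableaux ≤ N!`, and all are equalities. -/

/-! ### Derivatives of confluent Vandermonde determinants -/

section ShiftedForms

variable {K : Type*} [Field K] {N : ℕ}

/-- The divided power `t_j ^ (m - i) / (m - i)!`, which is `0` if `i > m`. -/
noncomputable def dividedPower (K : Type*) [Field K] {N : ℕ} (m i : ℕ) (j : Fin N) :
    MvPolynomial (Fin N) K :=
  if i ≤ m then MvPolynomial.C (((m - i)! : K)⁻¹) * MvPolynomial.X j ^ (m - i) else 0

theorem pderiv_dividedPower_self [CharZero K] (m i : ℕ) (j : Fin N) :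
    MvPolynomial.pderiv j (dividedPower K m i j) = dividedPower K m (i + 1) j := by
  unfold dividedPower
  by_cases h : i + 1 ≤ m
  · obtain ⟨d, rfl⟩ := Nat.exists_eq_add_of_le h
    have h1 : i + 1 + d - i = d + 1 := by omega
    have h2 : i + 1 + d - (i + 1) = d := by omega
    rw [if_pos h, if_pos (by omega), h1, h2, MvPolynomial.pderiv_C_mul, MvPolynomial.pderiv_pow,
      MvPolynomial.pderiv_X_self, Nat.factorial_succ, Nat.add_sub_cancel]
    have h3 : ((d + 1 : ℕ) : MvPolynomial (Fin N) K) = MvPolynomial.C ((d + 1 : ℕ) : K) := by simp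
    rw [h3, mul_one, ← mul_assoc, ← MvPolynomial.C_mul]
    have h4 : (((d + 1) * d ! : ℕ) : K)⁻¹ * ((d + 1 : ℕ) : K) = ((d ! : ℕ) : K)⁻¹ := by
      have : ((d + 1 : ℕ) : K) ≠ 0 := by exact_mod_cast Nat.succ_ne_zero d
      have : ((d ! : ℕ) : K) ≠ 0 := by exact_mod_cast Nat.factorial_ne_zero d
      push_cast at *
      field_simp
    rw [h4]
  · rw [if_neg h]
    split_ifs with h'
    · have : m - i = 0 := by omega
      simp [this]
    · simp

theorem pderiv_dividedPower_of_ne (m i : ℕ) {j l : Fin N} (h : j ≠ l) :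
    MvPolynomial.pderiv l (dividedPower K m i j) = 0 := by
  unfold dividedPower
  split_ifs
  · rw [MvPolynomial.pderiv_C_mul, MvPolynomial.pderiv_pow, MvPolynomial.pderiv_X_of_ne h]
    simp
  · simp

theorem Derivation.map_prod_eq_zero {R A ι : Type*} [CommSemiring R] [CommSemiring A] [Algebra R A]
    (D : Derivation R A A) (f : ι → A) (s : Finset ι) (h : ∀ i ∈ s, D (f i) = 0) :
    D (∏ i ∈ s, f i) = 0 := by
  classical
  induction s using Finset.induction_on with
  | empty => simp
  | insert a s ha ih =>
    rw [Finset.prod_insert ha, D.leibniz, h a (by simp),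
      ih fun i hi => h i (Finset.mem_insert_of_mem hi)]
    simp

/-- The determinant whose column `j` consists of the divided powers of `t_j` with exponents
`N - 1 - a_j - i`. -/
noncomputable def shiftedForm (K : Type*) [Field K] {N : ℕ} (a : Fin N → ℕ) :
    MvPolynomial (Fin N) K :=
  Matrix.det (Matrix.of fun i j : Fin N => dividedPower K (N - 1) ((i : ℕ) + a j) j)

theorem partialDeriv_shiftedForm [CharZero K] (a : Fin N → ℕ) (l : Fin N) :
    partialDeriv K l (shiftedForm K a) = shiftedForm K (a + Pi.single l 1) := by
  unfold partialDeriv shiftedForm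
  rw [Matrix.det_apply, Matrix.det_apply, map_sum]
  refine Finset.sum_congr rfl fun σ _ => ?_
  rw [Units.smul_def, Units.smul_def, map_zsmul]
  congr 1
  simp only [Matrix.of_apply]
  rw [← Finset.mul_prod_erase _ _ (Finset.mem_univ l),
    ← Finset.mul_prod_erase _ _ (Finset.mem_univ l), Derivation.coeFn_coe, Derivation.leibniz,
    Derivation.map_prod_eq_zero, pderiv_dividedPower_self, smul_zero, zero_add, smul_eq_mul,
    mul_comm]
  · congr 1
    · simp [add_assoc]
    · refine Finset.prod_congr rfl fun i hi => ?_
      simp [Finset.ne_of_mem_erase hi]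
  · intro i hi
    exact pderiv_dividedPower_of_ne _ _ (Finset.ne_of_mem_erase hi)

theorem partialDeriv_pow_shiftedForm [CharZero K] (a : Fin N → ℕ) (l : Fin N) (k : ℕ) :
    (partialDeriv K l ^ k) (shiftedForm K a) = shiftedForm K (a + Pi.single l k) := by
  induction k with
  | zero => simp
  | succ k ih =>
    rw [pow_succ', Module.End.mul_apply, ih, partialDeriv_shiftedForm, add_assoc,
      ← Pi.single_add]

/-- By Cramer's rule the `j`-th summand is the `j`-th diagonal entry of `adj(A) M A`; the trace is
cyclic and `A adj(A) = det(A)`. -/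
theorem Matrix.sum_det_updateCol_mul {n R : Type*} [Fintype n] [DecidableEq n] [CommRing R]
    (M A : Matrix n n R) :
    ∑ j, (A.updateCol j fun i => (M * A) i j).det = M.trace * A.det := by
  have h : ∀ j, (A.updateCol j fun i => (M * A) i j).det = (A.adjugate * (M * A)) j j := by
    intro j
    rw [← Matrix.cramer_apply, Matrix.cramer_eq_adjugate_mulVec]
    rfl
  simp_rw [h]
  change (A.adjugate * (M * A)).trace = _
  rw [Matrix.trace_mul_comm, Matrix.mul_assoc, Matrix.mul_adjugate, Matrix.mul_smul,
    Matrix.trace_smul, mul_one, smul_eq_mul, mul_comm]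

theorem sum_shiftedForm_add_single {k : ℕ} (hk : 1 ≤ k) (a : Fin N → ℕ) :
    ∑ l, shiftedForm K (a + Pi.single l k) = 0 := by
  let A : Matrix (Fin N) (Fin N) (MvPolynomial (Fin N) K) :=
    Matrix.of fun i j : Fin N => dividedPower K (N - 1) ((i : ℕ) + a j) j
  let M : Matrix (Fin N) (Fin N) (MvPolynomial (Fin N) K) :=
    Matrix.of fun i i' : Fin N => if (i' : ℕ) = i + k then 1 else 0
  have hM : M.trace = 0 := by
    refine Finset.sum_eq_zero fun i _ => ?_
    have : (i : ℕ) ≠ i + k := by omega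
    simp only [M, Matrix.diag_apply, Matrix.of_apply, if_neg this]
  have h := Matrix.sum_det_updateCol_mul M A
  rw [hM, zero_mul] at h
  rw [← h]
  refine Finset.sum_congr rfl fun l _ => ?_
  unfold shiftedForm
  congr 1
  ext1 i j
  by_cases hj : j = l
  · subst hj
    simp only [Matrix.of_apply, Pi.add_apply, Pi.single_eq_same, Matrix.updateCol_self,
      Matrix.mul_apply, M, A, ite_mul, one_mul, zero_mul]
    by_cases hi : (i : ℕ) + k < N
    · rw [Finset.sum_eq_single (⟨i + k, hi⟩ : Fin N)]
      · simp [add_assoc, add_comm k]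
      · intro b _ hb
        exact if_neg fun h => hb (Fin.ext h)
      · simp
    -- Rows pushed beyond the last one vanish on both sides: the divided power would have negative
    -- exponent.
    · rw [Finset.sum_eq_zero]
      · unfold dividedPower
        rw [if_neg]
        omega
      · intro b _
        exact if_neg (by omega)
  · simp [hj, A]

theorem cvForm_eq_shiftedForm (n : Fin N → Fin N) :
    cvForm K n = shiftedForm K fun i => N - 1 - (n i : ℕ) := by
  unfold cvForm shiftedForm dividedPower
  congr 1
  ext1 i j
  have := (n j).isLt
  simp only [Matrix.of_apply]
  by_cases h : (i : ℕ) ≤ n j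
  · rw [if_pos h, if_pos (by omega)]
    have : N - 1 - ((i : ℕ) + (N - 1 - n j)) = (n j : ℕ) - i := by omega
    rw [this]
  · rw [if_neg h, if_neg (by omega)]

theorem prod_Ioi_sub_eq_factorial (i : Fin N) :
    ∏ j ∈ Finset.Ioi i, ((j : ℕ) - (i : ℕ)) = (N - 1 - (i : ℕ))! := by
  rw [← Finset.prod_range_add_one_eq_factorial]
  refine Finset.prod_bij (fun j _ => (j : ℕ) - i - 1) ?_ ?_ ?_ ?_
  · intro j hj
    have := Finset.mem_Ioi.1 hj
    simp only [Finset.mem_range]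
    omega
  · intro j hj j' hj' h
    have := Finset.mem_Ioi.1 hj
    have := Finset.mem_Ioi.1 hj'
    omega
  · intro b hb
    have := Finset.mem_range.1 hb
    exact ⟨⟨i + b + 1, by omega⟩, Finset.mem_Ioi.2 (Fin.lt_def.2 (by simp only; omega)), by
      simp only; omega⟩
  · intro j hj
    have := Finset.mem_Ioi.1 hj
    omega

theorem shiftedForm_zero : shiftedForm K (0 : Fin N → ℕ) = vandermondeForm K N := by
  have h1 : ∀ i : Fin N, ∏ j ∈ Finset.Ioi i,
      MvPolynomial.C (σ := Fin N) ((((j : ℕ) : K) - ((i : ℕ) : K))⁻¹) =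
      MvPolynomial.C (((N - 1 - (i : ℕ))! : K)⁻¹) := by
    intro i
    rw [← map_prod, Finset.prod_inv_distrib, ← prod_Ioi_sub_eq_factorial, Nat.cast_prod]
    congr 2
    refine Finset.prod_congr rfl fun j hj => ?_
    rw [Nat.cast_sub (Fin.le_def.1 (Finset.mem_Ioi.1 hj).le)]
  -- The projective version has decreasing powers of `t_i`, which yields the factors `t_i - t_j`
  -- with the right sign.
  have h2 := Matrix.det_projVandermonde (fun _ : Fin N => (1 : MvPolynomial (Fin N) K))
    MvPolynomial.X
  simp only [one_mul] at h2
  unfold vandermondeForm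
  simp_rw [Finset.prod_mul_distrib, h1]
  rw [← h2, ← Matrix.det_transpose, ← Matrix.det_mul_column]
  unfold shiftedForm
  congr 1
  ext1 i j
  have : (i : ℕ) ≤ N - 1 := by omega
  have h : N - ((i : ℕ) + 1) = N - 1 - i := by omega
  simp [dividedPower, Matrix.projVandermonde, Matrix.rectVandermonde, this, Fin.val_rev, h]

end ShiftedForms

/-! ### Polynomials acting as differential operators -/

section DifferentialOperators

variable {K : Type*} [Field K] {N : ℕ}

theorem partialDeriv_commute (i j : Fin N) : Commute (partialDeriv K i) (partialDeriv K j) := by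
  refine LinearMap.ext fun p => ?_
  change MvPolynomial.pderiv i (MvPolynomial.pderiv j p) =
    MvPolynomial.pderiv j (MvPolynomial.pderiv i p)
  rcases eq_or_ne i j with rfl | h
  · rfl
  ext m
  simp only [MvPolynomial.coeff_pderiv, Finsupp.add_apply, Finsupp.single_eq_of_ne h,
    Finsupp.single_eq_of_ne h.symm, add_zero, add_right_comm m]
  ring

open scoped IsMulCommutative in
/-- The action of polynomials as constant coefficient differential operators, `t_i` acting
as the partial derivative with respect to `t_i`. -/
noncomputable def differentialOperator (K : Type*) [Field K] (N : ℕ) :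
    MvPolynomial (Fin N) K →ₐ[K] Module.End K (MvPolynomial (Fin N) K) :=
  -- Evaluation of polynomials needs a commutative target, hence the detour through the subalgebra
  -- generated by the partial derivatives.
  haveI : IsMulCommutative (Algebra.adjoin K (Set.range (partialDeriv K (N := N)))) :=
    Algebra.isMulCommutative_adjoin K (by
      rintro _ ⟨i, rfl⟩ _ ⟨j, rfl⟩
      exact partialDeriv_commute i j)
  (Subalgebra.val _).comp (MvPolynomial.aeval fun i =>
    (⟨partialDeriv K i, Algebra.subset_adjoin ⟨i, rfl⟩⟩ :
      Algebra.adjoin K (Set.range (partialDeriv K (N := N)))))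

@[simp] theorem differentialOperator_X (i : Fin N) :
    differentialOperator K N (MvPolynomial.X i) = partialDeriv K i := by
  simp [differentialOperator]

theorem differentialOperator_psum (k : ℕ) :
    differentialOperator K N (MvPolynomial.psum (Fin N) K k) = symmetrizedDeriv K N k := by
  simp [MvPolynomial.psum, symmetrizedDeriv]

theorem differentialOperator_prod_X_pow (a : Fin N → ℕ) :
    differentialOperator K N (∏ i, MvPolynomial.X i ^ a i) = iteratedPartialDeriv K a := by
  rw [← List.prod_ofFn, map_list_prod, List.map_ofFn]
  simp [iteratedPartialDeriv, Function.comp_def]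

theorem iteratedPartialDeriv_mul (a b : Fin N → ℕ) :
    iteratedPartialDeriv K a * iteratedPartialDeriv K b = iteratedPartialDeriv K (a + b) := by
  simp_rw [← differentialOperator_prod_X_pow, ← map_mul, ← Finset.prod_mul_distrib, ← pow_add]
  rfl

theorem iteratedPartialDeriv_shiftedForm [CharZero K] (a b : Fin N → ℕ) :
    iteratedPartialDeriv K a (shiftedForm K b) = shiftedForm K (b + a) := by
  have h : ∀ s : Finset (Fin N),
      differentialOperator K N (∏ i ∈ s, MvPolynomial.X i ^ a i) (shiftedForm K b) =
        shiftedForm K (b + ∑ i ∈ s, Pi.single i (a i)) := by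
    intro s
    induction s using Finset.induction_on with
    | empty => simp
    | insert i s hi ih =>
      rw [Finset.prod_insert hi, map_mul, Module.End.mul_apply, ih, map_pow,
        differentialOperator_X, partialDeriv_pow_shiftedForm, Finset.sum_insert hi, add_assoc,
        add_comm (∑ i ∈ s, _)]
  rw [← differentialOperator_prod_X_pow, h, Finset.univ_sum_single]

theorem mem_harmonicPolynomials {h : MvPolynomial (Fin N) K} :
    h ∈ harmonicPolynomials K N ↔ ∀ k, 1 ≤ k → symmetrizedDeriv K N k h = 0 := by
  simp [harmonicPolynomials]

theorem shiftedForm_mem_harmonicPolynomials [CharZero K] (a : Fin N → ℕ) :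
    shiftedForm K a ∈ harmonicPolynomials K N := by
  refine mem_harmonicPolynomials.2 fun k hk => ?_
  simp only [symmetrizedDeriv, LinearMap.sum_apply, partialDeriv_pow_shiftedForm]
  exact sum_shiftedForm_add_single hk a

/-- Newton's identity writes `k e_k` as a combination of `e_a p_{k-a}` with `a < k`, whose power
sums kill `h`; characteristic zero allows division by `k`. -/
theorem differentialOperator_esymm_apply [CharZero K] {h : MvPolynomial (Fin N) K}
    (hh : h ∈ harmonicPolynomials K N) {k : ℕ} (hk : 1 ≤ k) :
    differentialOperator K N (MvPolynomial.esymm (Fin N) K k) h = 0 := by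
  have e := congrArg (fun p => differentialOperator K N p h)
    (MvPolynomial.mul_esymm_eq_sum (Fin N) K k)
  have e2 : differentialOperator K N ((-1) ^ (k + 1) *
      ∑ a ∈ Finset.HasAntidiagonal.antidiagonal k with a.1 < k,
        (-1) ^ a.1 * MvPolynomial.esymm (Fin N) K a.1 * MvPolynomial.psum (Fin N) K a.2) h = 0 := by
    rw [map_mul, Module.End.mul_apply, map_sum, LinearMap.sum_apply, Finset.sum_eq_zero, map_zero]
    intro a ha
    have ha := Finset.mem_filter.1 ha
    have := Finset.HasAntidiagonal.mem_antidiagonal.1 ha.1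
    rw [map_mul, Module.End.mul_apply, differentialOperator_psum,
      mem_harmonicPolynomials.1 hh _ (by omega), map_zero]
  simp only [e2, ← nsmul_eq_mul, map_nsmul, LinearMap.smul_apply] at e
  exact (smul_eq_zero.1 e).resolve_left (by omega)

theorem sum_iteratedPartialDeriv_add_indicator [CharZero K] {h : MvPolynomial (Fin N) K}
    (hh : h ∈ harmonicPolynomials K N) (c : Fin N → ℕ) {k : ℕ} (hk : 1 ≤ k) :
    ∑ S ∈ Finset.powersetCard k Finset.univ,
      iteratedPartialDeriv K (c + fun i => if i ∈ S then 1 else 0) h = 0 := by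
  have e : ∑ S ∈ Finset.powersetCard k Finset.univ,
      iteratedPartialDeriv K (c + fun i => if i ∈ S then 1 else 0) =
      iteratedPartialDeriv K c * differentialOperator K N (MvPolynomial.esymm (Fin N) K k) := by
    rw [MvPolynomial.esymm, map_sum, Finset.mul_sum]
    refine Finset.sum_congr rfl fun S _ => ?_
    rw [← iteratedPartialDeriv_mul, ← differentialOperator_prod_X_pow (fun i => if i ∈ S then 1 else 0)]
    simp [pow_ite, Finset.prod_ite_mem]
  rw [← LinearMap.sum_apply, e, Module.End.mul_apply, differentialOperator_esymm_apply hh hk,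
    map_zero]

theorem coeff_partialDeriv_pow (p : MvPolynomial (Fin N) K) (i : Fin N) (k : ℕ)
    (m : Fin N →₀ ℕ) :
    ((partialDeriv K i ^ k) p).coeff m =
      ((m i + 1).ascFactorial k : K) * p.coeff (m + Finsupp.single i k) := by
  induction k generalizing m with
  | zero => simp
  | succ k ih =>
    rw [pow_succ', Module.End.mul_apply]
    change (MvPolynomial.pderiv i _).coeff m = _
    rw [MvPolynomial.coeff_pderiv, ih, Nat.ascFactorial_succ, ← Nat.succ_ascFactorial, add_assoc,
      ← Finsupp.single_add, add_comm 1 k]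
    simp
    ring

/-- Up to a nonzero factor, iterated derivatives shift coefficients. -/
theorem exists_coeff_iteratedPartialDeriv [CharZero K] (a : Fin N → ℕ) (m : Fin N →₀ ℕ) :
    ∃ c : K, c ≠ 0 ∧ ∀ p : MvPolynomial (Fin N) K,
      (iteratedPartialDeriv K a p).coeff m = c * p.coeff (m + Finsupp.equivFunOnFinite.symm a) := by
  have h : ∀ (s : Finset (Fin N)) (m : Fin N →₀ ℕ), ∃ c : K, c ≠ 0 ∧
      ∀ p : MvPolynomial (Fin N) K,
        (differentialOperator K N (∏ i ∈ s, MvPolynomial.X i ^ a i) p).coeff m =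
          c * p.coeff (m + ∑ i ∈ s, Finsupp.single i (a i)) := by
    intro s
    induction s using Finset.induction_on with
    | empty => exact fun m => ⟨1, one_ne_zero, by simp⟩
    | insert i s hi ih =>
      intro m
      obtain ⟨c, hc, H⟩ := ih (m + Finsupp.single i (a i))
      refine ⟨((m i + 1).ascFactorial (a i) : K) * c, mul_ne_zero ?_ hc, fun p => ?_⟩
      · exact_mod_cast (Nat.ascFactorial_pos _ _).ne'
      · rw [Finset.prod_insert hi, map_mul, Module.End.mul_apply, map_pow,
          differentialOperator_X, coeff_partialDeriv_pow, H, Finset.sum_insert hi, add_assoc,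
          mul_assoc]
  obtain ⟨c, hc, H⟩ := h Finset.univ m
  refine ⟨c, hc, fun p => ?_⟩
  rw [← differentialOperator_prod_X_pow, H]
  congr 3
  ext i
  simp [Finsupp.finsetSum_apply, Finsupp.single_apply]

theorem eq_zero_of_coeff_zero_iteratedPartialDeriv [CharZero K] {p : MvPolynomial (Fin N) K}
    (h : ∀ a, (iteratedPartialDeriv K a p).coeff 0 = 0) : p = 0 := by
  ext m
  obtain ⟨c, hc, H⟩ := exists_coeff_iteratedPartialDeriv (K := K) m 0
  have e := H p
  rw [h, zero_add] at e
  have e' := (mul_eq_zero.1 e.symm).resolve_left hc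
  simpa using e'

end DifferentialOperators

/-! ### Straightening of exponents -/

section Straightening

variable {N : ℕ}

/-- An injective key refining the order of the exponents `a i`; ties are broken by the position. -/
def exponentKey (a : Fin N → ℕ) (i : Fin N) : ℕ := N * a i + (i.rev : ℕ)

/-- An exponent is reduced if it is not of the form `c + 1_S` with `S` nonempty and consisting of
the positions with the largest keys with respect to `c`. -/
def IsReducedExponent (a : Fin N → ℕ) : Prop :=
  ∀ S : Finset (Fin N), S.Nonempty →
    ∃ i ∈ S, exponentKey a i < N ∨ ∃ j ∉ S, exponentKey a i ≤ exponentKey a j + N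

/-- The quantity that decreases under straightening. -/
def exponentEnergy (a : Fin N → ℕ) : ℕ := ∑ i, (N * a i ^ 2 + 2 * (i.rev : ℕ) * a i)

/-- Up to a constant, `N` times the energy is the sum of the squared keys, and adding `1_S` raises
each key in `S` by `N`. For fixed `c` and `|S|`, the energy is thus governed by the key sum over
`S`. -/
theorem exponentEnergy_add_indicator (c : Fin N → ℕ) (S : Finset (Fin N)) :
    exponentEnergy (c + fun i => if i ∈ S then 1 else 0) =
      exponentEnergy c + 2 * ∑ i ∈ S, exponentKey c i + S.card * N := by
  have h : ∀ i, N * (c + (fun i => if i ∈ S then 1 else 0 : Fin N → ℕ)) i ^ 2 +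
      2 * (i.rev : ℕ) * (c + (fun i => if i ∈ S then 1 else 0 : Fin N → ℕ)) i =
      (N * c i ^ 2 + 2 * (i.rev : ℕ) * c i) +
        if i ∈ S then 2 * exponentKey c i + N else 0 := by
    intro i
    unfold exponentKey
    by_cases hi : i ∈ S
    · simp only [Pi.add_apply, if_pos hi]
      ring
    · simp [hi]
  unfold exponentEnergy
  simp_rw [h]
  simp [Finset.sum_add_distrib, Finset.mul_sum, add_assoc]

theorem Finset.sum_lt_sum_of_card_eq_of_forall_lt {ι : Type*} [DecidableEq ι] (f : ι → ℕ)
    {S T : Finset ι} (hcard : S.card = T.card) (hne : S ≠ T)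
    (h : ∀ i ∈ T, ∀ j ∉ T, f j < f i) : ∑ i ∈ S, f i < ∑ i ∈ T, f i := by
  have hc : (S \ T).card = (T \ S).card := Finset.card_sdiff_comm hcard
  have hn : (S \ T).Nonempty := by
    rw [Finset.sdiff_nonempty]
    exact fun hs => hne (Finset.eq_of_subset_of_card_le hs hcard.ge)
  obtain ⟨m, hm, hmax⟩ := Finset.exists_max_image _ f hn
  have h1 : ∑ i ∈ S \ T, f i ≤ (S \ T).card • f m := Finset.sum_le_card_nsmul _ _ _ hmax
  have h2 : (T \ S).card • (f m + 1) ≤ ∑ i ∈ T \ S, f i :=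
    Finset.card_nsmul_le_sum _ _ _ fun i hi =>
      h i (Finset.mem_sdiff.1 hi).1 m (Finset.mem_sdiff.1 hm).2
  have h3 : 0 < (S \ T).card := hn.card_pos
  have h4 := Finset.sum_inter_add_sum_sdiff S T f
  have h5 := Finset.sum_inter_add_sum_sdiff T S f
  rw [Finset.inter_comm] at h5
  rw [← hc, smul_add, smul_eq_mul] at h2
  simp only [smul_eq_mul] at h1 h2
  omega

theorem mem_of_forall_isReducedExponent {K M : Type*} [Ring K] [AddCommGroup M] [Module K M]
    (W : Submodule K M) (F : (Fin N → ℕ) → M)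
    (hF : ∀ (c : Fin N → ℕ) (k : ℕ), 1 ≤ k →
      ∑ S ∈ Finset.powersetCard k Finset.univ, F (c + fun i => if i ∈ S then 1 else 0) = 0)
    (hW : ∀ a, IsReducedExponent a → F a ∈ W) (a : Fin N → ℕ) : F a ∈ W := by
  induction h : exponentEnergy a using Nat.strong_induction_on generalizing a with
  | _ e ih =>
  by_cases ha : IsReducedExponent a
  · exact hW a ha
  unfold IsReducedExponent at ha
  push Not at ha
  obtain ⟨S, hS, H⟩ := ha
  -- A key at least `N` forces a positive exponent, because its remainder `i.rev` is below `N`. So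
  -- the truncated subtraction defining `c` is exact.
  have hpos : ∀ i ∈ S, 1 ≤ a i := by
    intro i hi
    have := (H i hi).1
    unfold exponentKey at this
    by_contra hlt
    have h0 : a i = 0 := by omega
    rw [h0] at this
    omega
  let c : Fin N → ℕ := fun i => a i - if i ∈ S then 1 else 0
  have hac : a = c + fun i => if i ∈ S then 1 else 0 := by
    funext i
    by_cases hi : i ∈ S
    · have := hpos i hi
      simp only [c, Pi.add_apply, if_pos hi]
      omega
    · simp [c, hi]
  have hkey : ∀ i ∈ S, ∀ j ∉ S, exponentKey c j < exponentKey c i := by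
    intro i hi j hj
    have h1 := (H i hi).2 j hj
    have h2 : exponentKey a i = exponentKey c i + N := by
      rw [hac]
      simp only [exponentKey, Pi.add_apply, if_pos hi]
      ring
    have h3 : exponentKey a j = exponentKey c j := by
      rw [hac]
      simp [exponentKey, hj]
    omega
  have hsum := hF c S.card hS.card_pos
  rw [← Finset.add_sum_erase _ _ (Finset.mem_powersetCard.2 ⟨Finset.subset_univ S, rfl⟩),
    ← hac] at hsum
  rw [eq_neg_of_add_eq_zero_left hsum]
  refine W.neg_mem (W.sum_mem fun T hT => ?_)
  have hT' := Finset.mem_erase.1 hT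
  have hcard := (Finset.mem_powersetCard.1 hT'.2).2
  refine ih _ ?_ _ rfl
  have := Finset.sum_lt_sum_of_card_eq_of_forall_lt (exponentKey c) hcard hT'.1 hkey
  rw [← h, hac, exponentEnergy_add_indicator, exponentEnergy_add_indicator, hcard]
  omega

end Straightening

/-! ### Positions of boxes along a ribbon -/

/-- The number of steps from the upper right box `(0, N - 1)` to the box `c` along a ribbon. -/
def boxPosition (N : ℕ) (c : ℕ × ℕ) : ℕ := c.1 + (N - 1 - c.2)

namespace Ribbon

variable {N : ℕ} (R : Ribbon N)

theorem mem_of_le_of_le {c x d : ℕ × ℕ} (hc : c ∈ R.cells) (hd : d ∈ R.cells) (h1 : c ≤ x)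
    (h2 : x ≤ d) : x ∈ R.cells := by
  obtain ⟨μ, lam, -, h⟩ := R.isSkew
  rw [h, Finset.mem_sdiff] at hc hd ⊢
  exact ⟨lam.isLowerSet h2 hd.1, fun hx => hc.2 (μ.isLowerSet h1 hx)⟩

/-- Boxes in equal position lie on a common diagonal; two different ones would, by order convexity
of skew diagrams, enclose a `2 × 2` square. -/
theorem boxPosition_injOn : Set.InjOn (boxPosition N) (R.cells : Set (ℕ × ℕ)) := by
  have key : ∀ c ∈ R.cells, ∀ d ∈ R.cells, c.1 ≤ d.1 → boxPosition N c = boxPosition N d →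
      c = d := by
    rintro ⟨i, j⟩ hc ⟨i', j'⟩ hd hle h
    have h1 := R.col_lt _ hc
    have h2 := R.col_lt _ hd
    simp only [boxPosition] at h h1 h2 hle
    rcases hle.eq_or_lt with rfl | hlt
    · ext <;> simp only
      omega
    · exfalso
      refine R.no_square i j ⟨hc, ?_, ?_, ?_⟩ <;>
        refine R.mem_of_le_of_le hc hd ?_ ?_ <;> rw [Prod.mk_le_mk] <;> omega
  intro c hc d hd h
  rcases le_total c.1 d.1 with hle | hle
  · exact key c hc d hd hle h
  · exact (key d hd c hc hle h.symm).symm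

theorem eq_upper_right {c : ℕ × ℕ} (hc : c ∈ R.cells) (h : boxPosition N c = 0) :
    c = (0, N - 1) :=
  R.boxPosition_injOn hc R.upper_right_mem (by rw [h]; simp [boxPosition])

/-- Every box except the upper right one is the left or the lower neighbour of the box that
precedes it. -/
theorem exists_pred {d : ℕ × ℕ} (hd : d ∈ R.cells) {p : ℕ} (hp : boxPosition N d = p + 1) :
    ∃ c ∈ R.cells, boxPosition N c = p ∧
      ((c.1 = d.1 ∧ c.2 = d.2 + 1) ∨ (c.2 = d.2 ∧ d.1 = c.1 + 1)) := by
  obtain ⟨w⟩ := R.connected.preconnected ⟨(0, N - 1), R.upper_right_mem⟩ ⟨d, hd⟩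
  -- A walk from the corner to `d` must leave the positions `≤ p`. Adjacent positions differ by one,
  -- so it does so by entering position `p + 1`, which only `d` occupies.
  obtain ⟨e, -, h1, h2⟩ := w.exists_boundary_dart {x | boxPosition N x.1 ≤ p}
    (by simp [boxPosition]) (by simp [hp])
  obtain ⟨⟨⟨x, hx⟩, ⟨y, hy⟩⟩, hadj⟩ := e
  have hadj' : boxGraph.Adj x y := hadj
  have hx' := R.col_lt x hx
  have hy' := R.col_lt y hy
  simp only [boxGraph] at hadj'
  simp only [Set.mem_ofPred_eq, boxPosition] at h1 h2
  have hyd : y = d := R.boxPosition_injOn hy hd (by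
    rw [hp]
    unfold boxPosition
    omega)
  subst hyd
  refine ⟨x, hx, ?_, ?_⟩
  · unfold boxPosition
    omega
  · omega

theorem exists_boxPosition_eq {d : ℕ × ℕ} (hd : d ∈ R.cells) {p : ℕ} (hp : p ≤ boxPosition N d) :
    ∃ c ∈ R.cells, boxPosition N c = p := by
  induction hp using Nat.decreasingInduction with
  | self => exact ⟨d, hd, rfl⟩
  | of_succ k _ ih =>
    obtain ⟨c, hc, h⟩ := ih
    obtain ⟨c', hc', h', -⟩ := R.exists_pred hc h
    exact ⟨c', hc', h'⟩

theorem boxPosition_lt {d : ℕ × ℕ} (hd : d ∈ R.cells) : boxPosition N d < N := by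
  have h : Finset.range (boxPosition N d + 1) ⊆ R.cells.image (boxPosition N) := by
    intro p hp
    obtain ⟨c, hc, h⟩ := R.exists_boxPosition_eq hd (Nat.lt_succ_iff.1 (Finset.mem_range.1 hp))
    exact Finset.mem_image.2 ⟨c, hc, h⟩
  have h' := (Finset.card_le_card h).trans Finset.card_image_le
  rw [Finset.card_range, R.card_cells] at h'
  exact h'

end Ribbon

namespace StandardRibbonTableau

variable {N : ℕ} (T : StandardRibbonTableau N)

/-- The box with a given entry. -/
def box (e : Fin N) : ℕ × ℕ := (T.entry.symm e).1

theorem box_mem (e : Fin N) : T.box e ∈ T.shape.cells := (T.entry.symm e).2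

theorem box_entry {c : ℕ × ℕ} (hc : c ∈ T.shape.cells) : T.box (T.entry ⟨c, hc⟩) = c := by
  simp [box]

theorem box_injective : Function.Injective T.box :=
  Subtype.val_injective.comp T.entry.symm.injective

theorem lt_of_row {e f : Fin N} (h : (T.box e).1 = (T.box f).1) (h' : (T.box e).2 < (T.box f).2) :
    e < f := by
  simpa using T.row_lt (T.entry.symm e) (T.entry.symm f) h h'

theorem lt_of_col {e f : Fin N} (h : (T.box e).2 = (T.box f).2) (h' : (T.box e).1 < (T.box f).1) :
    e < f := by
  simpa using T.col_lt (T.entry.symm e) (T.entry.symm f) h h'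

theorem ext_of_box {T T' : StandardRibbonTableau N} (h : T.box = T'.box) : T = T' := by
  have hcells : ∀ U : StandardRibbonTableau N, U.shape.cells = Finset.univ.image U.box := by
    intro U
    ext c
    simp only [Finset.mem_image, Finset.mem_univ, true_and]
    exact ⟨fun hc => ⟨_, U.box_entry hc⟩, by rintro ⟨e, rfl⟩; exact U.box_mem e⟩
  have hc : T.shape.cells = T'.shape.cells := by rw [hcells, hcells, h]
  obtain ⟨⟨cells, _, _, _, _, _, _⟩, entry, _, _⟩ := T
  obtain ⟨⟨cells', _, _, _, _, _, _⟩, entry', _, _⟩ := T'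
  simp only at hc
  subst hc
  have he : entry = entry' := by
    apply Equiv.symm_bijective.injective
    ext1 e
    exact Subtype.ext (congrFun h e)
  subst he
  rfl

/-- The position along the ribbon of the box with a given entry. -/
def position (e : Fin N) : Fin N :=
  ⟨boxPosition N (T.box e), T.shape.boxPosition_lt (T.box_mem e)⟩

theorem position_injective : Function.Injective T.position := fun e f h =>
  T.box_injective (T.shape.boxPosition_injOn (T.box_mem e) (T.box_mem f) (Fin.ext_iff.1 h))

theorem position_bijective : Function.Bijective T.position :=
  Finite.injective_iff_bijective.1 T.position_injective

/-- The shape is recovered box by box from the corner: the next box lies to the left if its entry is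
smaller than the preceding one, and below if it is larger. -/
theorem eq_of_position_eq {T T' : StandardRibbonTableau N} (h : T.position = T'.position) :
    T = T' := by
  have hpos : ∀ e, boxPosition N (T.box e) = boxPosition N (T'.box e) := fun e =>
    Fin.ext_iff.1 (congrFun h e)
  have key : ∀ (p : ℕ) (e : Fin N), boxPosition N (T.box e) = p → T.box e = T'.box e := by
    intro p
    induction p with
    | zero =>
      intro e he
      rw [T.shape.eq_upper_right (T.box_mem e) he,
        T'.shape.eq_upper_right (T'.box_mem e) ((hpos e).symm.trans he)]
    | succ p ih =>
      intro e he
      obtain ⟨c, hc, hcp, hcd⟩ := T.shape.exists_pred (T.box_mem e) he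
      obtain ⟨c', hc', hcp', hcd'⟩ := T'.shape.exists_pred (T'.box_mem e) ((hpos e).symm.trans he)
      obtain ⟨f, rfl⟩ : ∃ f, T.box f = c := ⟨_, T.box_entry hc⟩
      have hf : T'.box f = c' := T'.shape.boxPosition_injOn (T'.box_mem f) hc'
        (by rw [← hpos, hcp, hcp'])
      rw [← hf, ← ih f hcp] at hcd'
      have hfb := ih f hcp
      rcases hcd with ⟨h1, h2⟩ | ⟨h1, h2⟩ <;> rcases hcd' with ⟨h3, h4⟩ | ⟨h3, h4⟩
      · ext <;> omega
      · have hlt : e < f := T.lt_of_row h1.symm (by omega)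
        have hlt' : f < e := T'.lt_of_col (by rw [← hfb, h3]) (by rw [← hfb]; omega)
        exact absurd hlt hlt'.asymm
      · have hlt : f < e := T.lt_of_col h1 (by omega)
        have hlt' : e < f := T'.lt_of_row (by rw [← hfb, h3]) (by rw [← hfb]; omega)
        exact absurd hlt hlt'.asymm
      · ext <;> omega
  exact ext_of_box (funext fun e => key _ e rfl)

/-- The permutation that sends each entry to its position along the ribbon. -/
noncomputable def positionPerm : Equiv.Perm (Fin N) := Equiv.ofBijective _ T.position_bijective

theorem positionPerm_injective :
    Function.Injective (positionPerm : StandardRibbonTableau N → Equiv.Perm (Fin N)) :=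
  fun _ _ h => eq_of_position_eq (congrArg (fun σ : Equiv.Perm (Fin N) => (σ : Fin N → Fin N)) h)

instance : Finite (StandardRibbonTableau N) := Finite.of_injective _ positionPerm_injective

theorem card_le_factorial : Nat.card (StandardRibbonTableau N) ≤ N ! := by
  refine (Nat.card_le_card_of_injective _ positionPerm_injective).trans ?_
  rw [Nat.card_eq_fintype_card, Fintype.card_perm, Fintype.card_fin]

theorem reverseReading_val (i : Fin N) : (T.reverseReading i : ℕ) = (T.box i.rev).2 := rfl

theorem index_eq_sum_box : T.index = ∑ e, (T.box e).1 := by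
  unfold index
  rw [← Finset.sum_coe_sort]
  exact (Equiv.sum_comp T.entry.symm fun c => c.1.1).symm

theorem sum_reverseReading :
    ∑ i, (T.reverseReading i : ℕ) = T.index + N * (N - 1) / 2 := by
  have h1 : ∑ i, (T.reverseReading i : ℕ) = ∑ e, (T.box e).2 := by
    simp_rw [reverseReading_val]
    exact Equiv.sum_comp Fin.revPerm fun e => (T.box e).2
  have h2 : ∑ e, (T.position e : ℕ) = N * (N - 1) / 2 := by
    rw [Function.Bijective.sum_comp T.position_bijective fun p => (p : ℕ),
      Fin.sum_univ_eq_sum_range (fun p => p), Finset.sum_range_id]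
  -- Summing this relation gives the degree formula, as the positions run through `0, …, N - 1`.
  have h3 : ∀ e, (T.box e).2 + (T.position e : ℕ) = (T.box e).1 + (N - 1) := by
    intro e
    have := T.shape.col_lt _ (T.box_mem e)
    simp only [position, boxPosition]
    omega
  have h4 := Finset.sum_congr (rfl : (Finset.univ : Finset (Fin N)) = _) fun e _ => h3 e
  rw [Finset.sum_add_distrib, Finset.sum_add_distrib, ← index_eq_sum_box, h2, ← h1] at h4
  simp only [Finset.sum_const, Finset.card_univ, Fintype.card_fin, smul_eq_mul] at h4
  have h5 : Even (N * (N - 1)) := Nat.even_mul_pred_self N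
  obtain ⟨m, hm⟩ := h5
  omega

end StandardRibbonTableau

/-! ### Ribbon tableaux from lattice paths -/

section Paths

variable {N : ℕ}

/-- The ribbon whose `q`-th box, counted from the upper right one, lies in row `r q` and in
column `N - 1 - a q`. -/
def Ribbon.ofPath (hN : 1 ≤ N) (r a : Fin N → ℕ) (hr : Monotone r) (ha : Monotone a)
    (h : ∀ q, r q + a q = q) : Ribbon N where
  cells := Finset.univ.image fun q => (r q, N - 1 - a q)
  card_cells := by
    rw [Finset.card_image_of_injective, Finset.card_univ, Fintype.card_fin]
    intro q q' hq
    simp only [Prod.mk.injEq] at hq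
    have := h q
    have := h q'
    ext
    omega
  isSkew := by
    -- The outer diagram consists of all boxes weakly above and left of some path box; the inner one
    -- omits those weakly below and right of some path box.
    let inLam : ℕ × ℕ → Prop := fun x => ∃ q, x.1 ≤ r q ∧ x.2 ≤ N - 1 - a q
    let inMu : ℕ × ℕ → Prop := fun x => inLam x ∧ ∀ q, r q ≤ x.1 → x.2 < N - 1 - a q
    classical
    have hlam : ∀ x, inLam x → x ∈ Finset.range N ×ˢ Finset.range N := by
      rintro x ⟨q, h1, h2⟩
      have := h q
      rw [Finset.mem_product, Finset.mem_range, Finset.mem_range]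
      omega
    let lam : YoungDiagram :=
      { cells := (Finset.range N ×ˢ Finset.range N).filter inLam
        isLowerSet := by
          intro x y hyx hx
          obtain ⟨q, h1, h2⟩ := (Finset.mem_filter.1 hx).2
          have hy : inLam y := ⟨q, hyx.1.trans h1, hyx.2.trans h2⟩
          exact Finset.mem_filter.2 ⟨hlam y hy, hy⟩ }
    let μ : YoungDiagram :=
      { cells := (Finset.range N ×ˢ Finset.range N).filter inMu
        isLowerSet := by
          intro x y hyx hx
          obtain ⟨⟨q, h1, h2⟩, h3⟩ := (Finset.mem_filter.1 hx).2
          have hy : inLam y := ⟨q, hyx.1.trans h1, hyx.2.trans h2⟩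
          exact Finset.mem_filter.2 ⟨hlam y hy, hy, fun q hq =>
            hyx.2.trans_lt (h3 q (hq.trans hyx.1))⟩ }
    refine ⟨μ, lam, ?_, ?_⟩
    · intro x hx
      have hx' := Finset.mem_filter.1 hx
      exact Finset.mem_filter.2 ⟨hx'.1, hx'.2.1⟩
    · ext ⟨i, j⟩
      simp only [Finset.mem_image, Finset.mem_univ, true_and, Finset.mem_sdiff, μ, lam,
        Finset.mem_filter, Prod.mk.injEq]
      constructor
      · rintro ⟨q, rfl, rfl⟩
        have hq : inLam (r q, N - 1 - a q) := ⟨q, le_rfl, le_rfl⟩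
        exact ⟨⟨hlam _ hq, hq⟩, fun h' => (h'.2.2 q le_rfl).false⟩
      · rintro ⟨⟨hmem, hl⟩, hm⟩
        have hm' : ∃ q, r q ≤ i ∧ N - 1 - a q ≤ j := by
          by_contra hcon
          push Not at hcon
          exact hm ⟨hmem, hl, hcon⟩
        obtain ⟨q', h1, h2⟩ := hl
        obtain ⟨q, h3, h4⟩ := hm'
        simp only at h1 h2
        have hq := h q
        have hq' := h q'
        have hqN := q.isLt
        have hqN' := q'.isLt
        -- The box is pinched between two path boxes. By monotonicity both share its column (first
        -- case) or its row (second case), so the path passes through it at position `i + (N - 1 -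
        -- j)`.
        rcases le_total q q' with hle | hle
        · have hap := ha hle
          have hlt : i + (N - 1 - j) < N := by omega
          have e1 := ha (a := q) (b := ⟨i + (N - 1 - j), hlt⟩) (by rw [Fin.le_def]; simp only; omega)
          have e2 := ha (b := q') (a := ⟨i + (N - 1 - j), hlt⟩) (by rw [Fin.le_def]; simp only; omega)
          have e3 := h ⟨i + (N - 1 - j), hlt⟩
          simp only at e3
          exact ⟨⟨i + (N - 1 - j), hlt⟩, by omega, by omega⟩
        · have hrp := hr hle
          have hlt : i + (N - 1 - j) < N := by omega
          have e1 := hr (a := q') (b := ⟨i + (N - 1 - j), hlt⟩)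
            (by rw [Fin.le_def]; simp only; omega)
          have e2 := hr (b := q) (a := ⟨i + (N - 1 - j), hlt⟩)
            (by rw [Fin.le_def]; simp only; omega)
          have e3 := h ⟨i + (N - 1 - j), hlt⟩
          simp only at e3
          exact ⟨⟨i + (N - 1 - j), hlt⟩, by omega, by omega⟩
  connected := by
    have hmem : ∀ q, (r q, N - 1 - a q) ∈
        ((Finset.univ.image fun q => (r q, N - 1 - a q) : Finset (ℕ × ℕ)) : Set (ℕ × ℕ)) :=
      fun q => Finset.mem_coe.2 (Finset.mem_image_of_mem _ (Finset.mem_univ q))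
    rw [SimpleGraph.connected_iff_exists_forall_reachable]
    refine ⟨⟨_, hmem ⟨0, hN⟩⟩, ?_⟩
    have hreach : ∀ (q : ℕ) (hq : q < N), (boxGraph.induce _).Reachable
        ⟨_, hmem ⟨0, hN⟩⟩ ⟨_, hmem ⟨q, hq⟩⟩ := by
      intro q
      induction q with
      | zero => exact fun _ => SimpleGraph.Reachable.rfl
      | succ q ih =>
        intro hq
        refine (ih (Nat.lt_of_succ_lt hq)).trans (SimpleGraph.Adj.reachable ?_)
        have h1 := h ⟨q, Nat.lt_of_succ_lt hq⟩
        have h2 := h ⟨q + 1, hq⟩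
        have hle : (⟨q, Nat.lt_of_succ_lt hq⟩ : Fin N) ≤ ⟨q + 1, hq⟩ := by simp
        have h3 := hr hle
        have h4 := ha hle
        simp only at h1 h2
        simp only [SimpleGraph.comap_adj, boxGraph, Function.Embedding.subtype_apply]
        omega
    rintro ⟨x, hx⟩
    obtain ⟨q, -, rfl⟩ := Finset.mem_image.1 (Finset.mem_coe.1 hx)
    exact hreach q q.isLt
  no_square := by
    rintro i j ⟨h1, -, -, h4⟩
    obtain ⟨q, -, hq⟩ := Finset.mem_image.1 h1
    obtain ⟨q', -, hq'⟩ := Finset.mem_image.1 h4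
    simp only [Prod.mk.injEq] at hq hq'
    have e1 := h q
    have e2 := h q'
    -- Opposite corners of the square would have the same position on the path.
    have : q = q' := by
      ext
      omega
    subst this
    omega
  upper_right_mem := by
    have := h ⟨0, hN⟩
    simp only at this
    exact Finset.mem_image.2 ⟨⟨0, hN⟩, Finset.mem_univ _, by ext <;> simp only <;> omega⟩
  col_lt := by
    intro c hc
    obtain ⟨q, -, rfl⟩ := Finset.mem_image.1 hc
    simp only
    omega

theorem StandardRibbonTableau.exists_of_path (hN : 1 ≤ N) (r a : Fin N → ℕ) (hr : Monotone r)
    (ha : Monotone a) (h : ∀ q, r q + a q = q) (e : Equiv.Perm (Fin N))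
    (hrow : ∀ (q : ℕ) (hq : q + 1 < N), r ⟨q + 1, hq⟩ = r ⟨q, Nat.lt_of_succ_lt hq⟩ →
      e ⟨q + 1, hq⟩ < e ⟨q, Nat.lt_of_succ_lt hq⟩)
    (hcol : ∀ (q : ℕ) (hq : q + 1 < N), a ⟨q + 1, hq⟩ = a ⟨q, Nat.lt_of_succ_lt hq⟩ →
      e ⟨q, Nat.lt_of_succ_lt hq⟩ < e ⟨q + 1, hq⟩) :
    ∃ T : StandardRibbonTableau N, ∀ q, T.box (e q) = (r q, N - 1 - a q) := by
  have hinj : Function.Injective fun q => (r q, N - 1 - a q) := by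
    intro q q' hq
    simp only [Prod.mk.injEq] at hq
    have := h q
    have := h q'
    ext
    omega
  have hmem : ∀ q, (r q, N - 1 - a q) ∈ (Ribbon.ofPath hN r a hr ha h).cells :=
    fun q => Finset.mem_image_of_mem _ (Finset.mem_univ q)
  let f : Fin N ≃ {c : ℕ × ℕ // c ∈ (Ribbon.ofPath hN r a hr ha h).cells} :=
    Equiv.ofBijective (fun q => ⟨_, hmem q⟩) ⟨fun q q' hq => hinj (congrArg Subtype.val hq), by
      rintro ⟨x, hx⟩
      obtain ⟨q, -, rfl⟩ := Finset.mem_image.1 hx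
      exact ⟨q, rfl⟩⟩
  have hf : ∀ q, (f q).1 = (r q, N - 1 - a q) := fun _ => rfl
  clear_value f
  -- By monotonicity the boxes of one row, or one column, are consecutive on the path, so the
  -- conditions on neighbours propagate.
  have hrow' : ∀ (p : Fin N) (q : ℕ), (p : ℕ) + 1 ≤ q → ∀ hq : q < N, r ⟨q, hq⟩ = r p →
      e ⟨q, hq⟩ < e p := by
    intro p q hpq
    induction q, hpq using Nat.le_induction with
    | base => exact fun hq => hrow p hq
    | succ q hpq ih =>
      intro hq hrq
      have h1 := hr (a := p) (b := ⟨q, Nat.lt_of_succ_lt hq⟩) (by rw [Fin.le_def]; simp only; omega)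
      have h2 := hr (a := ⟨q, Nat.lt_of_succ_lt hq⟩) (b := ⟨q + 1, hq⟩) (by simp)
      exact (hrow q hq (by omega)).trans (ih _ (by omega))
  have hcol' : ∀ (p : Fin N) (q : ℕ), (p : ℕ) + 1 ≤ q → ∀ hq : q < N, a ⟨q, hq⟩ = a p →
      e p < e ⟨q, hq⟩ := by
    intro p q hpq
    induction q, hpq using Nat.le_induction with
    | base => exact fun hq => hcol p hq
    | succ q hpq ih =>
      intro hq hrq
      have h1 := ha (a := p) (b := ⟨q, Nat.lt_of_succ_lt hq⟩) (by rw [Fin.le_def]; simp only; omega)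
      have h2 := ha (a := ⟨q, Nat.lt_of_succ_lt hq⟩) (b := ⟨q + 1, hq⟩) (by simp)
      exact (ih _ (by omega)).trans (hcol q hq (by omega))
  refine ⟨⟨Ribbon.ofPath hN r a hr ha h, f.symm.trans e, ?_, ?_⟩, fun q => ?_⟩
  · intro c d h1 h2
    obtain ⟨p, rfl⟩ := f.surjective c
    obtain ⟨q, rfl⟩ := f.surjective d
    simp only [hf] at h1 h2
    simp only [Equiv.trans_apply, Equiv.symm_apply_apply]
    have := h p
    have := h q
    exact hrow' q p (by omega) p.isLt h1
  · intro c d h1 h2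
    obtain ⟨p, rfl⟩ := f.surjective c
    obtain ⟨q, rfl⟩ := f.surjective d
    simp only [hf] at h1 h2
    simp only [Equiv.trans_apply, Equiv.symm_apply_apply]
    have := h p
    have := h q
    have := p.isLt
    have := q.isLt
    exact hcol' p q (by omega) q.isLt (by simp only [Fin.eta]; omega)
  · simp [StandardRibbonTableau.box, hf]

/-- In increasing order of keys, reducedness says that the first key is below `N` and that
successive gaps are at most `N`. In terms of quotient and remainder by `N`, either the exponent
stays and the remainder grows (a step down to a larger entry), or the exponent grows by one and the
remainder drops (a step left to a smaller entry). -/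
theorem IsReducedExponent.exists_tableau (hN : 1 ≤ N) {b : Fin N → ℕ} (hb : IsReducedExponent b) :
    ∃ T : StandardRibbonTableau N, ∀ i, N - 1 - (T.reverseReading i : ℕ) = b i := by
  let u := Tuple.sort (exponentKey b)
  have hu : Monotone fun q => exponentKey b (u q) := Tuple.monotone_sort (exponentKey b)
  have hzero : exponentKey b (u ⟨0, hN⟩) < N := by
    obtain ⟨i, -, hi⟩ := hb Finset.univ ⟨u ⟨0, hN⟩, Finset.mem_univ _⟩
    obtain ⟨q, rfl⟩ := u.surjective i
    have h0 := hu (a := ⟨0, hN⟩) (b := q) (Fin.le_def.2 (Nat.zero_le _))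
    simp only [Finset.mem_univ, not_true_eq_false, false_and, exists_false, or_false] at hi
    exact lt_of_le_of_lt h0 hi
  have hstep : ∀ (q : ℕ) (hq : q + 1 < N), exponentKey b (u ⟨q + 1, hq⟩) ≤
      exponentKey b (u ⟨q, Nat.lt_of_succ_lt hq⟩) + N := by
    intro q hq
    -- Reducedness is tested on the set of positions with the largest keys, a final segment of the
    -- sorted order.
    obtain ⟨i, hi, hi'⟩ := hb ((Finset.Ici ⟨q + 1, hq⟩).map u.toEmbedding)
      ⟨u ⟨q + 1, hq⟩, Finset.mem_map_of_mem _ (Finset.mem_Ici.2 le_rfl)⟩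
    obtain ⟨s, hs, rfl⟩ := Finset.mem_map.1 hi
    have h1 := hu (Finset.mem_Ici.1 hs)
    simp only [Equiv.coe_toEmbedding] at hi' h1
    rcases hi' with hi' | ⟨j, hj, hi'⟩
    · omega
    · obtain ⟨t, rfl⟩ := u.surjective j
      have ht : t ≤ ⟨q, Nat.lt_of_succ_lt hq⟩ := by
        by_contra hcon
        refine hj (Finset.mem_map_of_mem u.toEmbedding (Finset.mem_Ici.2 ?_))
        rw [Fin.le_def] at hcon ⊢
        simp only at hcon ⊢
        omega
      have h2 := hu ht
      simp only at h2
      omega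
  let a : Fin N → ℕ := fun q => b (u q)
  let ρ : Fin N → Fin N := fun q => (u q).rev
  have hkey : ∀ q, exponentKey b (u q) = N * a q + ρ q := fun q => rfl
  have ha0 : a ⟨0, hN⟩ = 0 := by
    rw [hkey] at hzero
    by_contra hne
    have : N * 1 ≤ N * a ⟨0, hN⟩ := Nat.mul_le_mul_left N (Nat.one_le_iff_ne_zero.2 hne)
    omega
  have hdich : ∀ (q : ℕ) (hq : q + 1 < N),
      (a ⟨q + 1, hq⟩ = a ⟨q, Nat.lt_of_succ_lt hq⟩ ∧
        ρ ⟨q, Nat.lt_of_succ_lt hq⟩ < ρ ⟨q + 1, hq⟩) ∨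
      (a ⟨q + 1, hq⟩ = a ⟨q, Nat.lt_of_succ_lt hq⟩ + 1 ∧
        ρ ⟨q + 1, hq⟩ < ρ ⟨q, Nat.lt_of_succ_lt hq⟩) := by
    intro q hq
    have h1 := hstep q hq
    have h2 := hu (a := ⟨q, Nat.lt_of_succ_lt hq⟩) (b := ⟨q + 1, hq⟩) (by simp)
    simp only [hkey] at h1 h2
    have h3 : ρ ⟨q, Nat.lt_of_succ_lt hq⟩ ≠ ρ ⟨q + 1, hq⟩ := by
      intro hcon
      have := u.injective (Fin.rev_injective hcon)
      simp at this
    have h4 := (ρ ⟨q, Nat.lt_of_succ_lt hq⟩).isLt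
    have h5 := (ρ ⟨q + 1, hq⟩).isLt
    rw [Fin.lt_def, Fin.lt_def]
    rw [Ne, Fin.ext_iff] at h3
    generalize (ρ ⟨q, Nat.lt_of_succ_lt hq⟩ : ℕ) = x at *
    generalize (ρ ⟨q + 1, hq⟩ : ℕ) = y at *
    generalize a ⟨q, Nat.lt_of_succ_lt hq⟩ = s at *
    generalize a ⟨q + 1, hq⟩ = t at *
    have hst : s ≤ t := by
      by_contra hcon
      have : N * (t + 1) ≤ N * s := Nat.mul_le_mul_left N (by omega)
      rw [Nat.mul_add] at this
      omega
    have hts : t ≤ s + 1 := by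
      by_contra hcon
      have : N * (s + 2) ≤ N * t := Nat.mul_le_mul_left N (by omega)
      rw [Nat.mul_add] at this
      omega
    rcases Nat.lt_or_ge s t with hlt | hge
    · obtain rfl : t = s + 1 := by omega
      rw [Nat.mul_add] at h1
      right
      omega
    · obtain rfl : t = s := by omega
      left
      omega
  have hale : ∀ (q : ℕ) (hq : q < N), a ⟨q, hq⟩ ≤ q := by
    intro q
    induction q with
    | zero => exact fun _ => ha0.le
    | succ q ih =>
      intro hq
      have := ih (Nat.lt_of_succ_lt hq)
      rcases hdich q hq with h | h <;> omega
  have hmono : ∀ g : Fin N → ℕ, (∀ (q : ℕ) (hq : q + 1 < N),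
      g ⟨q, Nat.lt_of_succ_lt hq⟩ ≤ g ⟨q + 1, hq⟩) → Monotone g := by
    intro g hg p q hpq
    obtain ⟨q, hq⟩ := q
    replace hpq : (p : ℕ) ≤ q := hpq
    induction q, hpq using Nat.le_induction with
    | base => exact le_rfl
    | succ q hpq ih => exact (ih (Nat.lt_of_succ_lt hq)).trans (hg q hq)
  obtain ⟨T, hT⟩ := StandardRibbonTableau.exists_of_path hN (fun q => (q : ℕ) - a q) a
    (hmono _ fun q hq => by
      have := hale q (Nat.lt_of_succ_lt hq)
      rcases hdich q hq with h | h <;> simp only <;> omega)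
    (hmono _ fun q hq => by rcases hdich q hq with h | h <;> omega)
    (fun q => Nat.sub_add_cancel (hale q q.isLt)) (u.trans Fin.revPerm)
    (fun q hq h => by
      have h1 := hale q (Nat.lt_of_succ_lt hq)
      have h2 := hale (q + 1) hq
      simp only at h
      rcases hdich q hq with h' | h'
      · omega
      · exact h'.2)
    (fun q hq h => by
      rcases hdich q hq with h' | h'
      · exact h'.2
      · omega)
  refine ⟨T, fun i => ?_⟩
  obtain ⟨q, rfl⟩ := u.surjective i
  have e1 : T.box (u q).rev = _ := hT q
  have e2 := hale q q.isLt
  have e3 := q.isLt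
  rw [StandardRibbonTableau.reverseReading_val, e1]
  simp only [Fin.eta, a] at e2 ⊢
  omega

end Paths

/-! ### Linear independence of the derivatives of the Vandermonde form -/

section Independence

variable {K : Type*} [Field K] {N : ℕ}

theorem MonomialOrder.linearIndependent_of_injective_degree {σ ι : Type*} (m : MonomialOrder σ)
    (F : ι → MvPolynomial σ K) (hF : ∀ i, F i ≠ 0)
    (hinj : Function.Injective fun i => m.degree (F i)) : LinearIndependent K F := by
  classical
  rw [linearIndependent_iff']
  intro s g hg
  by_contra! hcon
  obtain ⟨i₀, hi₀, hgi₀⟩ := hcon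
  obtain ⟨i, hi, hmax⟩ := Finset.exists_max_image (s.filter fun i => g i ≠ 0)
    (fun i => m.toSyn (m.degree (F i))) ⟨i₀, Finset.mem_filter.2 ⟨hi₀, hgi₀⟩⟩
  have hi' := Finset.mem_filter.1 hi
  have h := congrArg (MvPolynomial.coeff (m.degree (F i))) hg
  rw [MvPolynomial.coeff_sum, Finset.sum_eq_single_of_mem i hi'.1, MvPolynomial.coeff_smul,
    MvPolynomial.coeff_zero, smul_eq_mul] at h
  · exact mul_ne_zero hi'.2 (m.coeff_degree_ne_zero_iff.2 (hF i)) h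
  · intro j hj hji
    rw [MvPolynomial.coeff_smul]
    by_cases hgj : g j = 0
    · simp [hgj]
    · have hle := hmax j (Finset.mem_filter.2 ⟨hj, hgj⟩)
      have hne : m.toSyn (m.degree (F j)) ≠ m.toSyn (m.degree (F i)) := fun h =>
        hji (hinj (m.toSyn.injective h))
      rw [m.coeff_eq_zero_of_lt (lt_of_le_of_ne hle hne), smul_zero]

theorem degree_lex_X_sub_X {i j : Fin N} (h : i < j) :
    MonomialOrder.lex.degree (MvPolynomial.X i - MvPolynomial.X j : MvPolynomial (Fin N) K) =
      Finsupp.single i 1 := by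
  rw [MonomialOrder.degree_sub_of_lt, MonomialOrder.degree_X]
  rw [MonomialOrder.degree_X, MonomialOrder.degree_X, MonomialOrder.lex_lt_iff]
  exact Finsupp.Lex.single_lt_iff.2 h

theorem vandermondeForm_factor_ne_zero [CharZero K] {i j : Fin N} (h : i < j) :
    MvPolynomial.C ((((j : ℕ) : K) - ((i : ℕ) : K))⁻¹) *
      (MvPolynomial.X i - MvPolynomial.X j : MvPolynomial (Fin N) K) ≠ 0 := by
  refine mul_ne_zero ?_ ?_
  · rw [Ne, MvPolynomial.C_eq_zero, inv_eq_zero, sub_eq_zero]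
    exact_mod_cast (Fin.lt_def.1 h).ne'
  · exact sub_ne_zero.2 fun e => h.ne (MvPolynomial.X_injective e)

theorem vandermondeForm_ne_zero [CharZero K] : vandermondeForm K N ≠ 0 :=
  Finset.prod_ne_zero_iff.2 fun _ _ => Finset.prod_ne_zero_iff.2 fun _ hj =>
    vandermondeForm_factor_ne_zero (Finset.mem_Ioi.1 hj)

theorem degree_lex_vandermondeForm [CharZero K] :
    MonomialOrder.lex.degree (vandermondeForm K N) =
      Finsupp.equivFunOnFinite.symm fun i : Fin N => N - 1 - (i : ℕ) := by
  unfold vandermondeForm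
  rw [MonomialOrder.degree_prod fun i _ => Finset.prod_ne_zero_iff.2 fun j hj =>
    vandermondeForm_factor_ne_zero (Finset.mem_Ioi.1 hj)]
  have h : ∀ i : Fin N, MonomialOrder.lex.degree (∏ j ∈ Finset.Ioi i,
      MvPolynomial.C ((((j : ℕ) : K) - ((i : ℕ) : K))⁻¹) *
        (MvPolynomial.X i - MvPolynomial.X j : MvPolynomial (Fin N) K)) =
      Finsupp.single i (N - 1 - (i : ℕ)) := by
    intro i
    rw [MonomialOrder.degree_prod fun j hj =>
      vandermondeForm_factor_ne_zero (Finset.mem_Ioi.1 hj)]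
    have h' : ∀ j ∈ Finset.Ioi i, MonomialOrder.lex.degree
        (MvPolynomial.C ((((j : ℕ) : K) - ((i : ℕ) : K))⁻¹) *
          (MvPolynomial.X i - MvPolynomial.X j : MvPolynomial (Fin N) K)) =
        Finsupp.single i 1 := by
      intro j hj
      have hne := vandermondeForm_factor_ne_zero (K := K) (Finset.mem_Ioi.1 hj)
      rw [MonomialOrder.degree_mul (left_ne_zero_of_mul hne) (right_ne_zero_of_mul hne),
        MonomialOrder.degree_C, zero_add, degree_lex_X_sub_X (Finset.mem_Ioi.1 hj)]
    rw [Finset.sum_congr rfl h', Finset.sum_const, Fin.card_Ioi, Finsupp.smul_single]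
    simp
  simp_rw [h]
  ext i
  rw [Finsupp.finsetSum_apply, Finset.sum_eq_single i]
  · simp
  · exact fun j _ hj => Finsupp.single_eq_of_ne hj.symm
  · simp

theorem coeff_shiftedForm_ne_zero_iff [CharZero K] (a : Fin N → ℕ) (m : Fin N →₀ ℕ) :
    (shiftedForm K a).coeff m ≠ 0 ↔
      (vandermondeForm K N).coeff (m + Finsupp.equivFunOnFinite.symm a) ≠ 0 := by
  obtain ⟨c, hc, H⟩ := exists_coeff_iteratedPartialDeriv (K := K) a m
  have h := H (vandermondeForm K N)
  rw [← shiftedForm_zero, iteratedPartialDeriv_shiftedForm, zero_add] at h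
  rw [h, shiftedForm_zero]
  simp [hc]

/-- Differentiation translates the support of `Δ` by `-a`, up to nonzero factors, and translation
respects the monomial order. The bound on `a` ensures that the leading monomial survives. -/
theorem shiftedForm_ne_zero_and_degree_lex [CharZero K] (a : Fin N → ℕ)
    (ha : ∀ i, a i ≤ N - 1 - (i : ℕ)) :
    shiftedForm K a ≠ 0 ∧ MonomialOrder.lex.degree (shiftedForm K a) =
      Finsupp.equivFunOnFinite.symm fun i : Fin N => N - 1 - (i : ℕ) - a i := by
  set e : Fin N →₀ ℕ := Finsupp.equivFunOnFinite.symm fun i : Fin N => N - 1 - (i : ℕ) - a i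
    with he
  have hadd : e + Finsupp.equivFunOnFinite.symm a =
      MonomialOrder.lex.degree (vandermondeForm K N) := by
    rw [degree_lex_vandermondeForm]
    ext i
    simp [he, Nat.sub_add_cancel (ha i)]
  have hcoeff : (shiftedForm K a).coeff e ≠ 0 := by
    rw [coeff_shiftedForm_ne_zero_iff, hadd]
    exact MonomialOrder.lex.coeff_degree_ne_zero_iff.2 vandermondeForm_ne_zero
  refine ⟨fun h => hcoeff (by rw [h, MvPolynomial.coeff_zero]), ?_⟩
  refine MonomialOrder.lex.toSyn.injective (le_antisymm ?_ ?_)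
  · refine MonomialOrder.lex.degree_le_iff.2 fun f hf => ?_
    have h1 := MonomialOrder.lex.le_degree (MvPolynomial.mem_support_iff.2
      ((coeff_shiftedForm_ne_zero_iff a f).1 (MvPolynomial.mem_support_iff.1 hf)))
    rw [← hadd, map_add, map_add] at h1
    exact le_of_add_le_add_right h1
  · exact MonomialOrder.lex.le_degree (MvPolynomial.mem_support_iff.2 hcoeff)

theorem linearIndependent_shiftedForm [CharZero K] :
    LinearIndependent K fun x : (i : Fin N) → Fin ((i.rev : ℕ) + 1) =>
      shiftedForm K fun i => (x i : ℕ) := by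
  have hle : ∀ (x : (i : Fin N) → Fin ((i.rev : ℕ) + 1)) (i : Fin N),
      (x i : ℕ) ≤ N - 1 - (i : ℕ) := by
    intro x i
    have h1 := (x i).isLt
    have h2 := Fin.val_rev i
    omega
  refine MonomialOrder.lex.linearIndependent_of_injective_degree _
    (fun x => (shiftedForm_ne_zero_and_degree_lex _ (hle x)).1) fun x y hxy => ?_
  simp only [(shiftedForm_ne_zero_and_degree_lex _ (hle _)).2] at hxy
  funext i
  have h := congrFun (Finsupp.equivFunOnFinite.symm.injective hxy) i
  have h1 := hle x i
  have h2 := hle y i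
  ext
  omega

theorem card_staircase : Fintype.card ((i : Fin N) → Fin ((i.rev : ℕ) + 1)) = N ! := by
  simp only [Fintype.card_pi, Fintype.card_fin]
  rw [← Finset.prod_range_add_one_eq_factorial, ← Fin.prod_univ_eq_prod_range]
  exact Equiv.prod_comp Fin.revPerm fun i : Fin N => (i : ℕ) + 1

theorem cvForm_isHomogeneous (n : Fin N → Fin N) {d : ℕ}
    (hd : ∑ i, (n i : ℕ) = d + N * (N - 1) / 2) : (cvForm K n).IsHomogeneous d := by
  unfold cvForm
  rw [Matrix.det_apply]
  refine MvPolynomial.IsHomogeneous.sum _ _ _ fun σ _ => ?_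
  rw [Units.smul_def, zsmul_eq_mul, ← zero_add d]
  refine MvPolynomial.IsHomogeneous.mul ?_ ?_
  · rw [show ((((σ.sign : ℤˣ) : ℤ) : MvPolynomial (Fin N) K)) =
      MvPolynomial.C (((σ.sign : ℤˣ) : ℤ) : K) by simp]
    exact MvPolynomial.isHomogeneous_C _ _
  -- A permutation contributes a monomial of degree `∑ (n_i - σ_i)`, or zero if some difference is
  -- negative.
  · by_cases h : ∀ i, (σ i : ℕ) ≤ n i
    · have e : d = ∑ i, ((n i : ℕ) - (σ i : ℕ)) := by
        have h1 : ∑ i, (σ i : ℕ) = N * (N - 1) / 2 := by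
          rw [Equiv.sum_comp σ fun i => (i : ℕ), Fin.sum_univ_eq_sum_range (fun p => p),
            Finset.sum_range_id]
        have h2 : ∑ i, ((n i : ℕ) - (σ i : ℕ)) + ∑ i, (σ i : ℕ) = ∑ i, (n i : ℕ) := by
          rw [← Finset.sum_add_distrib]
          exact Finset.sum_congr rfl fun i _ => Nat.sub_add_cancel (h i)
        omega
      rw [e]
      refine MvPolynomial.IsHomogeneous.prod _ _ _ fun i _ => ?_
      rw [Matrix.of_apply, if_pos (h i)]
      exact MvPolynomial.isHomogeneous_C_mul_X_pow _ _ _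
    · push Not at h
      obtain ⟨i, hi⟩ := h
      rw [Finset.prod_eq_zero (Finset.mem_univ i)]
      · exact MvPolynomial.isHomogeneous_zero _ _ _
      · rw [Matrix.of_apply, if_neg hi.not_ge]

end Independence

/-! ### The basis of harmonic polynomials -/

section Basis

theorem cvForm_reverseReading_isHomogeneous (K : Type*) [Field K] {N : ℕ}
    (T : StandardRibbonTableau N) :
    (cvForm K T.reverseReading).IsHomogeneous T.index :=
  cvForm_isHomogeneous _ T.sum_reverseReading

variable (K : Type*) [Field K] [CharZero K] {N : ℕ}

theorem shiftedForm_mem_span_cvForm (hN : 1 ≤ N) (a : Fin N → ℕ) :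
    shiftedForm K a ∈
      Submodule.span K (Set.range fun T : StandardRibbonTableau N => cvForm K T.reverseReading) := by
  refine mem_of_forall_isReducedExponent _ _ (fun c k hk => ?_) (fun b hb => ?_) a
  · have h := sum_iteratedPartialDeriv_add_indicator
      (shiftedForm_mem_harmonicPolynomials (K := K) (0 : Fin N → ℕ)) c hk
    simpa only [iteratedPartialDeriv_shiftedForm, zero_add] using h
  · obtain ⟨T, hT⟩ := hb.exists_tableau hN
    refine Submodule.subset_span ⟨T, ?_⟩
    simp only [cvForm_eq_shiftedForm, hT]

/-- Straightening into the zero subspace of `K`: constant terms vanishing for tableau exponents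
vanish for all exponents, and these recover every coefficient of `h`. -/
theorem eq_zero_of_coeff_zero_tableau (hN : 1 ≤ N) {h : MvPolynomial (Fin N) K}
    (hh : h ∈ harmonicPolynomials K N)
    (h0 : ∀ T : StandardRibbonTableau N,
      (iteratedPartialDeriv K (fun i => N - 1 - (T.reverseReading i : ℕ)) h).coeff 0 = 0) :
    h = 0 := by
  refine eq_zero_of_coeff_zero_iteratedPartialDeriv fun a => ?_
  rw [← Submodule.mem_bot K]
  refine mem_of_forall_isReducedExponent (⊥ : Submodule K K)
    (fun a => (iteratedPartialDeriv K a h).coeff 0) (fun c k hk => ?_) (fun b hb => ?_) a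
  · simp only [← MvPolynomial.coeff_sum, sum_iteratedPartialDeriv_add_indicator hh c hk,
      MvPolynomial.coeff_zero]
  · obtain ⟨T, hT⟩ := hb.exists_tableau hN
    have := h0 T
    simp only [hT] at this
    exact (Submodule.mem_bot K).2 this

/-- The constant terms of the derivatives of a harmonic polynomial that belong to tableaux. -/
noncomputable def tableauPairing (N : ℕ) :
    harmonicPolynomials K N →ₗ[K] StandardRibbonTableau N → K :=
  LinearMap.pi fun T => MvPolynomial.lcoeff K 0 ∘ₗ
    iteratedPartialDeriv K (fun i => N - 1 - (T.reverseReading i : ℕ)) ∘ₗ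
      (harmonicPolynomials K N).subtype

theorem tableauPairing_injective (hN : 1 ≤ N) : Function.Injective (tableauPairing K N) := by
  rw [← LinearMap.ker_eq_bot, LinearMap.ker_eq_bot']
  intro h hh
  exact Subtype.ext (eq_zero_of_coeff_zero_tableau K hN h.2 fun T => congrFun hh T)

theorem finiteDimensional_harmonicPolynomials (hN : 1 ≤ N) :
    FiniteDimensional K (harmonicPolynomials K N) :=
  Module.Finite.of_injective _ (tableauPairing_injective K hN)

theorem finrank_harmonicPolynomials_le (hN : 1 ≤ N) :
    Module.finrank K (harmonicPolynomials K N) ≤ Nat.card (StandardRibbonTableau N) := by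
  have := Fintype.ofFinite (StandardRibbonTableau N)
  refine (LinearMap.finrank_le_finrank_of_injective (tableauPairing_injective K hN)).trans ?_
  rw [Module.finrank_fintype_fun_eq_card, Nat.card_eq_fintype_card]

theorem span_cvForm_le_harmonicPolynomials :
    Submodule.span K (Set.range fun T : StandardRibbonTableau N => cvForm K T.reverseReading) ≤
      harmonicPolynomials K N := by
  rw [Submodule.span_le]
  rintro _ ⟨T, rfl⟩
  simp only [cvForm_eq_shiftedForm]
  exact shiftedForm_mem_harmonicPolynomials _

theorem factorial_le_finrank_span_cvForm (hN : 1 ≤ N) :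
    N ! ≤ Module.finrank K (Submodule.span K
      (Set.range fun T : StandardRibbonTableau N => cvForm K T.reverseReading)) := by
  have : FiniteDimensional K (Submodule.span K
      (Set.range fun T : StandardRibbonTableau N => cvForm K T.reverseReading)) :=
    FiniteDimensional.span_of_finite K (Set.finite_range _)
  rw [← card_staircase, ← finrank_span_eq_card (linearIndependent_shiftedForm (K := K))]
  refine Submodule.finrank_mono (Submodule.span_le.2 ?_)
  rintro _ ⟨x, rfl⟩
  exact shiftedForm_mem_span_cvForm K hN _

theorem span_cvForm_eq_harmonicPolynomials (hN : 1 ≤ N) :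
    Submodule.span K (Set.range fun T : StandardRibbonTableau N => cvForm K T.reverseReading) =
      harmonicPolynomials K N := by
  have := finiteDimensional_harmonicPolynomials K hN
  exact Submodule.eq_of_le_of_finrank_le (span_cvForm_le_harmonicPolynomials K)
    ((finrank_harmonicPolynomials_le K hN).trans
      (StandardRibbonTableau.card_le_factorial.trans (factorial_le_finrank_span_cvForm K hN)))

theorem finrank_harmonicPolynomials (hN : 1 ≤ N) :
    Module.finrank K (harmonicPolynomials K N) = N ! :=
  le_antisymm ((finrank_harmonicPolynomials_le K hN).trans StandardRibbonTableau.card_le_factorial)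
    (span_cvForm_eq_harmonicPolynomials K hN ▸ factorial_le_finrank_span_cvForm K hN)

/-- The count does not involve a field, so the dimension over `ℚ` serves. -/
theorem StandardRibbonTableau.card_eq_factorial (hN : 1 ≤ N) :
    Nat.card (StandardRibbonTableau N) = N ! :=
  le_antisymm StandardRibbonTableau.card_le_factorial
    (finrank_harmonicPolynomials ℚ hN ▸ finrank_harmonicPolynomials_le ℚ hN)

theorem linearIndependent_cvForm (hN : 1 ≤ N) :
    LinearIndependent K (fun T : StandardRibbonTableau N => cvForm K T.reverseReading) := by
  have := Fintype.ofFinite (StandardRibbonTableau N)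
  rw [linearIndependent_iff_card_eq_finrank_span, Set.finrank,
    span_cvForm_eq_harmonicPolynomials K hN, finrank_harmonicPolynomials K hN,
    ← Nat.card_eq_fintype_card, StandardRibbonTableau.card_eq_factorial hN]

/-- Equal readings give equal forms, whereas a linearly independent family has no repetitions. -/
theorem StandardRibbonTableau.reverseReading_injective (hN : 1 ≤ N) :
    Function.Injective
      (StandardRibbonTableau.reverseReading : StandardRibbonTableau N → Fin N → Fin N) :=
  fun _ _ h => (linearIndependent_cvForm ℚ hN).injective (congrArg (cvForm ℚ) h)

theorem span_cvForm_index_eq (hN : 1 ≤ N) (d : ℕ) :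
    Submodule.span K
        ((fun T : StandardRibbonTableau N => cvForm K T.reverseReading) '' {T | T.index = d}) =
      harmonicPolynomials K N ⊓ MvPolynomial.homogeneousSubmodule (Fin N) K d := by
  apply le_antisymm
  · rw [Submodule.span_le]
    rintro _ ⟨T, rfl, rfl⟩
    exact ⟨span_cvForm_le_harmonicPolynomials K (Submodule.subset_span ⟨T, rfl⟩),
      cvForm_reverseReading_isHomogeneous K T⟩
  · rintro h ⟨h1, h2⟩
    rw [SetLike.mem_coe, ← span_cvForm_eq_harmonicPolynomials K hN] at h1
    have h3 : MvPolynomial.homogeneousComponent d h = h := by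
      rw [MvPolynomial.homogeneousComponent_of_mem h2, if_pos rfl]
    rw [← h3]
    -- The projection to degree `d` fixes `h` and keeps or kills each spanning form, according to
    -- its index.
    refine Submodule.span_induction (p := fun x _ => MvPolynomial.homogeneousComponent d x ∈ _)
      ?_ ?_ ?_ ?_ h1
    · rintro _ ⟨T, rfl⟩
      rw [MvPolynomial.homogeneousComponent_of_mem (cvForm_reverseReading_isHomogeneous K T)]
      split_ifs with hd
      · exact Submodule.subset_span ⟨T, hd.symm, rfl⟩
      · exact Submodule.zero_mem _
    · simp
    · intro x y _ _ hx hy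
      rw [map_add]
      exact Submodule.add_mem _ hx hy
    · intro c x _ hx
      rw [map_smul]
      exact Submodule.smul_mem _ c hx

end Basis
theorem mainTheorem1 (K : Type*) [Field K] [CharZero K] (N : ℕ) (hN : 1 ≤ N) :
    -- confluent Vandermonde forms are the derivatives of the Vandermonde form
    (∀ n : Fin N → Fin N,
      cvForm K n = iteratedPartialDeriv K (fun i => N - 1 - (n i : ℕ)) (vandermondeForm K N)) ∧
    -- there are `N!` standard ribbon tableaux, and the reversed reading is injective on them
    Nat.card (StandardRibbonTableau N) = N ! ∧
    Function.Injective
      (StandardRibbonTableau.reverseReading : StandardRibbonTableau N → Fin N → Fin N) ∧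
    -- the encoded forms are linearly independent
    LinearIndependent K (fun T : StandardRibbonTableau N => cvForm K T.reverseReading) ∧
    -- the space of harmonic polynomials has dimension `N!`, and the encoded forms span it
    Module.finrank K (harmonicPolynomials K N) = N ! ∧
    Submodule.span K (Set.range fun T : StandardRibbonTableau N => cvForm K T.reverseReading) =
      harmonicPolynomials K N ∧
    -- the basis is graded
    (∀ T : StandardRibbonTableau N,
      (cvForm K T.reverseReading).IsHomogeneous T.index ∧
        ∑ i, (T.reverseReading i : ℕ) = T.index + N * (N - 1) / 2) ∧
    ∀ d : ℕ,
      Submodule.span K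
          ((fun T : StandardRibbonTableau N => cvForm K T.reverseReading) '' {T | T.index = d}) =
        harmonicPolynomials K N ⊓ MvPolynomial.homogeneousSubmodule (Fin N) K d := by
  refine ⟨fun n => ?_, StandardRibbonTableau.card_eq_factorial hN,
    StandardRibbonTableau.reverseReading_injective hN, linearIndependent_cvForm K hN,
    finrank_harmonicPolynomials K hN, span_cvForm_eq_harmonicPolynomials K hN,
    fun T => ⟨cvForm_reverseReading_isHomogeneous K T, T.sum_reverseReading⟩,
    span_cvForm_index_eq K hN⟩
  rw [← shiftedForm_zero, iteratedPartialDeriv_shiftedForm, zero_add, cvForm_eq_shiftedForm]
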